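/- There is a function $\varepsilon:\mathbb N\to\mathbb R$ with $\varepsilon(n)\to 0$ as $n\to\infty$ such that for every positive integer $n$ there exists a triangulation of the real projective space $\mathbb{RP}^{n-1}$ (a finite simplicial complex whose underlying space is homeomorphic to $\mathbb{RP}^{n-1}$) with at most $$e^{\left(\frac12+\varepsilon(n)\right)\sqrt n\,\log n}$$ vertices. -/

import Mathlib

open scoped LinearAlgebra.Projectivization Topology

/-- The projectivization `ℙ K V` of a topological vector space `V` carries the quotient topology
of the space of nonzero vectors under scaling. -/
instance Projectivization.instTopologicalSpaceQuotient {K V : Type*} [DivisionRing K]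
    [AddCommGroup V] [Module K V] [TopologicalSpace V] : TopologicalSpace (ℙ K V) :=
  inferInstanceAs (TopologicalSpace (Quotient (projectivizationSetoid K V)))

/-- The `d`-dimensional real projective space: the space of lines through the origin
in `ℝ^(d+1)`. -/
abbrev RealProjectiveSpace (d : ℕ) : Type := ℙ ℝ (Fin (d + 1) → ℝ)

/-- A (finite) triangulation of a topological space `X`: a geometric simplicial complex with
finitely many vertices in some `ℝ^m`, with a homeomorphism from its underlying space onto `X`. -/
structure Triangulation (X : Type*) [TopologicalSpace X] where
  /-- The dimension of the ambient space of the complex. -/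
  ambientDim : ℕ
  /-- The simplicial complex. -/
  complex : Geometry.SimplicialComplex ℝ (Fin ambientDim → ℝ)
  /-- There are finitely many vertices (hence finitely many simplices). -/
  finite_vertices : complex.vertices.Finite
  /-- The underlying space of the complex is homeomorphic to `X`. -/
  homeo : complex.space ≃ₜ X

/-- The number of vertices of a triangulation. -/
noncomputable def Triangulation.numVertices {X : Type*} [TopologicalSpace X]
    (T : Triangulation X) : ℕ :=
  T.complex.vertices.ncard

/-! A centrally symmetric complete simplicial fan in `ℝ^n` descends to a triangulation of projective
space once rays sharing a cone make acute angles: relative to a ray `v` of a cone, the sign of the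
scalar product with `v` decides which member of each antipodal pair the cone may use, so nothing
beyond `x ~ -x` is glued (`IsAcuteFan.exists_triangulation`). The vertices are the antipodal pairs
of rays.

Such a fan comes from linear programming: write each point as a nonnegative combination of the given
vectors at least cost. If every non-acute pair admits a strictly cheaper replacement, optimal
supports are acute; a generic symmetric perturbation of the cost makes optima unique
(`exists_isAcuteFan`).

The rays are sign vectors on a grid with about `√n` rows and columns, with at most one nonzero entry
per row outside one free row. The cost is a strictly increasing, strictly concave function of the
support size, so cancelling opposite entries, or making two sizes more unequal, is profitable; the
free row leaves room for these moves (`NearTransversal.hasExchange`). With `m ≈ √n` there are at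
most `m * 3 ^ m * (3 * m) ^ m` rays, and `m ^ m` dominates. -/

/-- A nonnegative coefficient vector which has minimal cost among all nonnegative coefficient
vectors with the same linear combination. -/
def IsOptimal {κ ι : Type*} [Fintype κ] (vec : κ → ι → ℝ) (p w : κ → ℝ) : Prop :=
  0 ≤ w ∧ ∀ u, 0 ≤ u → Fintype.linearCombination ℝ vec u = Fintype.linearCombination ℝ vec w →
    p ⬝ᵥ w ≤ p ⬝ᵥ u

/-- Coordinates `c` of a complete simplicial fan with rays `vec v`, symmetric under the involution
`neg`, all of whose cones are spanned by vectors with positive pairwise scalar products. -/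
structure IsAcuteFan {κ ι : Type*} [Fintype κ] [Fintype ι] (vec : κ → ι → ℝ) (neg : κ → κ)
    (c : (ι → ℝ) → κ → ℝ) : Prop where
  nonneg : ∀ x, 0 ≤ c x
  linearCombination_eq : ∀ x, Fintype.linearCombination ℝ vec (c x) = x
  eq_of_support : ∀ x w, 0 ≤ w → (∀ v, c x v = 0 → w v = 0) →
    c (Fintype.linearCombination ℝ vec w) = w
  neg_apply : ∀ x v, c (-x) (neg v) = c x v
  acute : ∀ x v w, c x v ≠ 0 → c x w ≠ 0 → 0 < vec v ⬝ᵥ vec w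
  continuous : Continuous c

/-- Every pair of rays at a non-acute angle can be exchanged for a cheaper combination. -/
def HasExchange {κ ι : Type*} [Fintype κ] [Fintype ι] (vec : κ → ι → ℝ) (p : κ → ℝ) : Prop :=
  ∀ v w, vec v ⬝ᵥ vec w ≤ 0 → ∃ a b : ℝ, ∃ u : κ → ℝ, 0 < a ∧ 0 < b ∧ 0 ≤ u ∧
    Fintype.linearCombination ℝ vec u = a • vec v + b • vec w ∧ p ⬝ᵥ u < a * p v + b * p w

/-! ### Acute fans from linear programming -/

section LinearProgram

variable {κ ι : Type*} [Fintype κ] {vec : κ → ι → ℝ} {p w : κ → ℝ}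

/-- First-order optimality: `w + t • d` remains feasible for small `t > 0`. Everything below about
optima is derived by choosing `d`. -/
theorem IsOptimal.dotProduct_nonneg (h : IsOptimal vec p w) {d : κ → ℝ}
    (hd : Fintype.linearCombination ℝ vec d = 0) (hd' : ∀ v, w v = 0 → 0 ≤ d v) :
    0 ≤ p ⬝ᵥ d := by
  have key : ∀ᶠ t in 𝓝[>] (0 : ℝ), ∀ v, 0 ≤ w v + t * d v := by
    rw [Filter.eventually_all]
    intro v
    rcases (h.1 v).eq_or_lt with h0 | h0
    · filter_upwards [self_mem_nhdsWithin] with t ht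
      rw [← h0]
      have := mul_nonneg (le_of_lt ht) (hd' v h0.symm)
      simpa using this
    · have : Filter.Tendsto (fun t : ℝ => w v + t * d v) (𝓝[>] 0) (𝓝 (w v + 0 * d v)) :=
        (Continuous.tendsto (by fun_prop) _).mono_left nhdsWithin_le_nhds
      have h1 : (0 : ℝ) < w v + 0 * d v := by simpa using h0
      exact (this.eventually (lt_mem_nhds h1)).mono fun t ht => ht.le
  obtain ⟨t, ht, ht0⟩ := (key.and self_mem_nhdsWithin).exists
  have := h.2 (w + t • d) (fun v => by simpa using ht v) (by simp [hd])
  rw [dotProduct_add, dotProduct_smul, smul_eq_mul] at this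
  have ht0 : 0 < t := ht0
  by_contra hc
  nlinarith [mul_neg_of_pos_of_neg ht0 (not_le.1 hc)]

theorem IsOptimal.of_support (h : IsOptimal vec p w) {u : κ → ℝ} (hu : 0 ≤ u)
    (hs : ∀ v, w v = 0 → u v = 0) : IsOptimal vec p u := by
  refine ⟨hu, fun z hz hzu => ?_⟩
  have := h.dotProduct_nonneg (d := z - u) (by rw [map_sub, hzu, sub_self]) fun v hv => by
    simpa [hs v hv] using hz v
  rw [dotProduct_sub] at this
  linarith

theorem IsOptimal.acute [Fintype ι] (h : IsOptimal vec p w) (hex : HasExchange vec p) {v v' : κ}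
    (hv : w v ≠ 0) (hv' : w v' ≠ 0) : 0 < vec v ⬝ᵥ vec v' := by
  classical
  by_contra hc
  obtain ⟨a, b, u, ha, hb, hu, hlin, hlt⟩ := hex v v' (not_lt.1 hc)
  have := h.dotProduct_nonneg (d := u - (a • Pi.single v 1 + b • Pi.single v' 1))
    (by simp [hlin, Fintype.linearCombination_apply_single]) fun x hx => by
      have h1 : x ≠ v := fun e => hv (e ▸ hx)
      have h2 : x ≠ v' := fun e => hv' (e ▸ hx)
      simpa [h1, h2] using hu x
  simp [dotProduct_sub, dotProduct_add, dotProduct_smul] at this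
  linarith

/-- Positive costs bound every coordinate on a sublevel set of the cost, so the minimum is taken
over a compact set. -/
theorem exists_isOptimal (hp : ∀ v, 0 < p v) {w : κ → ℝ} (hw : 0 ≤ w) :
    ∃ u, IsOptimal vec p u ∧
      Fintype.linearCombination ℝ vec u = Fintype.linearCombination ℝ vec w := by
  set L := Fintype.linearCombination ℝ vec
  have hL : Continuous L := by
    refine continuous_pi fun i => ?_
    simp only [L, Fintype.linearCombination_apply, Finset.sum_apply, Pi.smul_apply]
    fun_prop
  have hc : Continuous fun u : κ → ℝ => p ⬝ᵥ u := by
    unfold dotProduct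
    fun_prop
  let K : Set (κ → ℝ) := {u | 0 ≤ u ∧ L u = L w ∧ p ⬝ᵥ u ≤ p ⬝ᵥ w}
  have hKc : IsClosed K := by
    refine IsClosed.inter isClosed_Ici (IsClosed.inter ?_ ?_)
    · exact isClosed_eq hL continuous_const
    · exact isClosed_le hc continuous_const
  have hK : IsCompact K := by
    refine (isCompact_Icc (a := (0 : κ → ℝ)) (b := fun v => (p ⬝ᵥ w) / p v)).of_isClosed_subset
      hKc fun u hu => ⟨hu.1, fun v => ?_⟩
    rw [le_div_iff₀ (hp v), mul_comm]
    refine le_trans ?_ hu.2.2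
    exact Finset.single_le_sum (f := fun v => p v * u v)
      (fun i _ => mul_nonneg (hp i).le (hu.1 i)) (Finset.mem_univ v)
  obtain ⟨u, hu, hmin⟩ := hK.exists_isMinOn ⟨w, hw, rfl, le_rfl⟩ hc.continuousOn
  refine ⟨u, ⟨hu.1, fun z hz hzu => ?_⟩, hu.2.1⟩
  by_cases hzw : p ⬝ᵥ z ≤ p ⬝ᵥ w
  · exact hmin ⟨hz, hzu.trans hu.2.1, hzw⟩
  · exact hu.2.2.trans (not_le.1 hzw).le

/-- No relation between vectors that contain no antipodal pair respects the cost `p`. -/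
def IsGenericCost (vec : κ → ι → ℝ) (neg : κ → κ) (p : κ → ℝ) : Prop :=
  ∀ D : Finset κ, (∀ v ∈ D, neg v ∉ D) →
    (∃ d : κ → ℝ, d ≠ 0 ∧ (∀ v ∉ D, d v = 0) ∧ Fintype.linearCombination ℝ vec d = 0) →
    ∃ d : κ → ℝ, (∀ v ∉ D, d v = 0) ∧ Fintype.linearCombination ℝ vec d = 0 ∧ p ⬝ᵥ d ≠ 0

/-- The sum of two optima is optimal, so its support is acute and contains no antipodal pair. Two
distinct optima would give a relation on that support, hence by genericity one of nonzero cost;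
moving along it in one direction or the other would lower the cost. -/
theorem IsOptimal.unique [Fintype ι] {neg : κ → κ} (hex : HasExchange vec p)
    (hneg : ∀ v, vec (neg v) = -vec v) (hgen : IsGenericCost vec neg p) {u : κ → ℝ}
    (hw : IsOptimal vec p w) (hu : IsOptimal vec p u)
    (h : Fintype.linearCombination ℝ vec u = Fintype.linearCombination ℝ vec w) : u = w := by
  classical
  by_contra hne
  set z : κ → ℝ := u + w with hz
  have hzero : ∀ v, z v = 0 → u v = 0 ∧ w v = 0 := fun v hv => by
    have h1 := hu.1 v
    have h2 := hw.1 v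
    simp only [hz, Pi.add_apply, Pi.zero_apply] at hv h1 h2
    constructor <;> linarith
  have hopt : IsOptimal vec p z := by
    refine ⟨add_nonneg hu.1 hw.1, fun y hy hyz => ?_⟩
    have := hw.2 ((1 / 2 : ℝ) • y) (smul_nonneg (by norm_num) hy) (by
      rw [map_smul, hyz, hz, map_add, h, ← two_smul ℝ, smul_smul]; norm_num)
    have h2 := hu.2 w hw.1 h.symm
    rw [dotProduct_smul, smul_eq_mul] at this
    rw [hz, dotProduct_add]
    linarith
  obtain ⟨d, hd, hd0, hdp⟩ := hgen (Finset.univ.filter fun v => z v ≠ 0) (fun v hv hv' => by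
    have := hopt.acute hex (Finset.mem_filter.1 hv).2 (Finset.mem_filter.1 hv').2
    rw [hneg, dotProduct_neg] at this
    have h0 : 0 ≤ vec v ⬝ᵥ vec v := Finset.sum_nonneg fun i _ => mul_self_nonneg _
    linarith)
    ⟨u - w, sub_ne_zero.2 hne, fun v hv => by
      have := hzero v (by simpa using hv)
      simp [this.1, this.2], by rw [map_sub, h, sub_self]⟩
  have hd' : ∀ v, z v = 0 → d v = 0 := fun v hv => hd v (by simpa using hv)
  have h1 := hopt.dotProduct_nonneg hd0 fun v hv => (hd' v hv).ge
  have h2 := hopt.dotProduct_nonneg (d := -d) (by rw [map_neg, hd0, neg_zero]) fun v hv => by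
    simp [hd' v hv]
  rw [dotProduct_neg] at h2
  exact hdp (by linarith)

/-- Symmetric costs can be perturbed to symmetric generic costs. -/
theorem exists_isGenericCost [Fintype ι] {neg : κ → κ} {e : κ → ℕ}
    (he : ∀ v w, e v = e w → w = v ∨ w = neg v) (he' : ∀ v, e (neg v) = e v)
    (hp : ∀ v, 0 < p v) (hps : ∀ v, p (neg v) = p v) (hex : HasExchange vec p) :
    ∃ q : κ → ℝ, (∀ v, 0 < q v) ∧ (∀ v, q (neg v) = q v) ∧ HasExchange vec q ∧
      IsGenericCost vec neg q := by
  classical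
  -- Antipodes share an exponent, which keeps the cost symmetric. The shift by one keeps the
  -- perturbation out of the constant term.
  let q : ℝ → κ → ℝ := fun t v => p v + t ^ (e v + 1)
  have hq : Continuous q := by
    refine continuous_pi fun v => ?_
    simp only [q]
    fun_prop
  have hq0 : q 0 = p := by
    ext v
    simp [q]
  have hdot : ∀ d : κ → ℝ, Continuous fun t => q t ⬝ᵥ d := fun d => by
    simp only [dotProduct, q]
    fun_prop
  have h1 : ∀ᶠ t in 𝓝[>] (0 : ℝ), ∀ v, 0 < q t v := by
    filter_upwards [self_mem_nhdsWithin] with t ht v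
    exact add_pos (hp v) (pow_pos ht _)
  have h2 : ∀ᶠ t in 𝓝[>] (0 : ℝ), HasExchange vec (q t) := by
    unfold HasExchange
    rw [Filter.eventually_all]
    intro v
    rw [Filter.eventually_all]
    intro w
    by_cases hvw : vec v ⬝ᵥ vec w ≤ 0
    · obtain ⟨a, b, u, ha, hb, hu, hlin, hlt⟩ := hex v w hvw
      have hev : ∀ᶠ t in 𝓝 (0 : ℝ), q t ⬝ᵥ u < a * q t v + b * q t w := by
        refine (hdot u).continuousAt.eventually_lt (Continuous.continuousAt ?_) ?_
        · simp only [q]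
          fun_prop
        · simpa [hq0] using hlt
      filter_upwards [nhdsWithin_le_nhds hev] with t ht _
      exact ⟨a, b, u, ha, hb, hu, hlin, ht⟩
    · exact Filter.Eventually.of_forall fun t h => absurd h hvw
  have h3 : ∀ᶠ t in 𝓝[>] (0 : ℝ), IsGenericCost vec neg (q t) := by
    unfold IsGenericCost
    rw [Filter.eventually_all]
    intro D
    by_cases hD : ∀ v ∈ D, neg v ∉ D
    swap
    · exact Filter.Eventually.of_forall fun t h => absurd h hD
    by_cases hr : ∃ d : κ → ℝ, d ≠ 0 ∧ (∀ v ∉ D, d v = 0) ∧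
        Fintype.linearCombination ℝ vec d = 0
    swap
    · exact Filter.Eventually.of_forall fun t _ h => absurd h hr
    obtain ⟨d, hd, hdD, hd0⟩ := hr
    obtain ⟨v₀, hv₀⟩ := Function.ne_iff.1 hd
    have hv₀D : v₀ ∈ D := by
      by_contra hc
      exact hv₀ (hdD _ hc)
    -- The perturbed cost of `d` as a polynomial in `t`. As `D` has no antipodal pair, no other term
    -- of `d` meets the exponent of `v₀`.
    let P : Polynomial ℝ := ∑ v, (Polynomial.C (p v * d v) + Polynomial.C (d v) *
      Polynomial.X ^ (e v + 1))
    have hP : P ≠ 0 := by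
      intro h0
      have : P.coeff (e v₀ + 1) = d v₀ := by
        simp only [P, Polynomial.finsetSum_coeff, Polynomial.coeff_add, Polynomial.coeff_C_succ,
          Polynomial.coeff_C_mul, Polynomial.coeff_X_pow, zero_add]
        rw [Finset.sum_eq_single v₀]
        · simp
        · intro v _ hv
          by_cases hev : e v₀ = e v
          · have : v = neg v₀ := (he v₀ v hev).resolve_left hv
            rw [hdD v (this ▸ hD v₀ hv₀D), zero_mul]
          · simp [hev]
        · simp
      rw [h0, Polynomial.coeff_zero] at this
      exact hv₀ this.symm
    have hroots : ∀ᶠ t in 𝓝[>] (0 : ℝ), t ∉ (P.roots.toFinset : Set ℝ) := by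
      -- Zero may itself be a root, but only positive `t` are used.
      have h : ∀ᶠ t in 𝓝 (0 : ℝ), t ∉ ((P.roots.toFinset.erase 0 : Finset ℝ) : Set ℝ) :=
        (Finset.finite_toSet _).isClosed.isOpen_compl.mem_nhds (by simp)
      filter_upwards [nhdsWithin_le_nhds h, self_mem_nhdsWithin] with t ht ht0 hmem
      exact ht (Finset.mem_coe.2 (Finset.mem_erase.2 ⟨ne_of_gt ht0, hmem⟩))
    filter_upwards [hroots] with t ht _ _
    refine ⟨d, hdD, hd0, fun h0 => ht ?_⟩
    rw [Finset.mem_coe, Multiset.mem_toFinset, Polynomial.mem_roots hP, Polynomial.IsRoot.def, ← h0]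
    simp only [P, Polynomial.eval_finsetSum, dotProduct, q]
    refine Finset.sum_congr rfl fun v _ => ?_
    simp
    ring
  obtain ⟨t, ⟨ht1, ht2⟩, ht3⟩ := ((h1.and h2).and h3).exists
  exact ⟨q t, ht1, fun v => by simp [q, he', hps], ht2, ht3⟩

/-- The coordinates of `x` are its unique optimal coefficients. Uniqueness yields the fan property
and the symmetry; together with continuity of the optimal cost it also yields continuity. -/
theorem exists_isAcuteFan [Fintype ι] [DecidableEq ι] {neg : κ → κ} {e : κ → ℕ}
    (hneg : ∀ v, vec (neg v) = -vec v) (hinv : Function.Involutive neg)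
    (he : ∀ v w, e v = e w → w = v ∨ w = neg v) (he' : ∀ v, e (neg v) = e v)
    (hp : ∀ v, 0 < p v) (hps : ∀ v, p (neg v) = p v) (hex : HasExchange vec p)
    (hspan : ∀ i, ∃ v, vec v = Pi.single i 1) :
    ∃ c, IsAcuteFan vec neg c := by
  classical
  obtain ⟨q, hq, hqs, hqex, hgen⟩ := exists_isGenericCost he he' hp hps hex
  set L := Fintype.linearCombination ℝ vec with hLdef
  have hL : Continuous L := by
    refine continuous_pi fun i => ?_
    simp only [L, Fintype.linearCombination_apply, Finset.sum_apply, Pi.smul_apply]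
    fun_prop
  choose s hs using hspan
  /- an explicit representation, of cost at most a multiple of the norm -/
  let r : (ι → ℝ) → κ → ℝ := fun x => ∑ i, ((x i)⁺ • Pi.single (s i) 1 +
    (x i)⁻ • Pi.single (neg (s i)) 1)
  have hr0 : ∀ x, 0 ≤ r x := fun x => Finset.sum_nonneg fun i _ => add_nonneg
    (smul_nonneg (posPart_nonneg _) (Pi.single_nonneg.2 zero_le_one))
    (smul_nonneg (negPart_nonneg _) (Pi.single_nonneg.2 zero_le_one))
  have hrL : ∀ x, L (r x) = x := fun x => by
    simp only [r, map_sum, map_add, map_smul, L, Fintype.linearCombination_apply_single, hneg, hs,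
      one_smul, smul_neg, ← sub_eq_add_neg, ← sub_smul, posPart_sub_negPart]
    ext j
    simp [Finset.sum_apply, Pi.single_apply]
  obtain ⟨C, hC⟩ : ∃ C : NNReal, ∀ x, q ⬝ᵥ r x ≤ C * ‖x‖ := by
    refine ⟨(∑ i, q (s i)).toNNReal, fun x => ?_⟩
    rw [Real.coe_toNNReal _ (Finset.sum_nonneg fun i _ => (hq _).le), Finset.sum_mul]
    simp only [r, dotProduct_sum, dotProduct_add, dotProduct_smul, dotProduct_single, mul_one,
      hqs, smul_eq_mul, ← add_mul, posPart_add_negPart]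
    refine Finset.sum_le_sum fun i _ => ?_
    rw [mul_comm]
    exact mul_le_mul_of_nonneg_left (norm_le_pi_norm x i) (hq (s i)).le
  choose c hc hcL using fun x => exists_isOptimal (vec := vec) hq (hr0 x)
  replace hcL : ∀ x, L (c x) = x := fun x => (hcL x).trans (hrL x)
  have huniq : ∀ w, IsOptimal vec q w → c (L w) = w := fun w hw =>
    IsOptimal.unique hqex hneg hgen hw (hc _) (hcL _)
  -- An optimum for `y` plus the explicit representation of `x - y` is feasible for `x`.
  have hlip : LipschitzWith C fun x => q ⬝ᵥ c x := by
    refine LipschitzWith.of_le_add_mul C fun x y => ?_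
    have := (hc x).2 (c y + r (x - y)) (add_nonneg (hc y).1 (hr0 _)) (by
      rw [← hLdef, map_add, hcL, hrL, hcL]; abel)
    rw [dotProduct_add] at this
    have h2 := hC (x - y)
    rw [dist_eq_norm]
    linarith
  refine ⟨c, fun x => (hc x).1, hcL, fun x w hw hs => huniq _ ((hc x).of_support hw hs),
    fun x v => ?_, fun x v w hv hw => (hc x).acute hqex hv hw, ?_⟩
  · have hsum : ∀ u : κ → ℝ, L (u ∘ neg) = - L u := fun u => by
      simp only [L, Fintype.linearCombination_apply, ← Finset.sum_neg_distrib]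
      refine Fintype.sum_equiv hinv.toPerm _ _ fun v => ?_
      simp [hneg]
    have hdot : ∀ u : κ → ℝ, q ⬝ᵥ (u ∘ neg) = q ⬝ᵥ u := fun u => by
      refine Fintype.sum_equiv hinv.toPerm _ _ fun v => ?_
      simp [hqs]
    have hopt : IsOptimal vec q (c x ∘ neg) := by
      refine ⟨fun v => (hc x).1 (neg v), fun u hu hux => ?_⟩
      rw [hdot, ← hdot u]
      refine (hc x).2 _ (fun v => hu (neg v)) ?_
      rw [← hLdef] at hux ⊢
      rw [hsum, hux, hsum, neg_neg]
    have := huniq _ hopt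
    rw [hsum, hcL] at this
    rw [this, Function.comp_apply, hinv v]
  · rw [continuous_iff_continuousAt]
    intro x
    rw [ContinuousAt, Filter.tendsto_iff_ultrafilter]
    intro g hg
    set K : Set (κ → ℝ) := Set.Icc 0 fun v => (q ⬝ᵥ c x + 1) / q v
    have hK : ∀ᶠ y in 𝓝 x, c y ∈ K := by
      filter_upwards [(hlip.continuous.tendsto x).eventually (gt_mem_nhds (lt_add_one _))]
        with y hy
      refine ⟨(hc y).1, fun v => ?_⟩
      rw [le_div_iff₀ (hq v), mul_comm]
      refine le_trans ?_ hy.le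
      exact Finset.single_le_sum (f := fun v => q v * c y v)
        (fun i _ => mul_nonneg (hq i).le ((hc y).1 i)) (Finset.mem_univ v)
    -- Any limit `z` of optima represents `x` at the optimal cost, so uniqueness forces `z = c x`.
    obtain ⟨z, -, hz⟩ := (isCompact_Icc : IsCompact K).ultrafilter_le_nhds (g.map c)
      (Filter.le_principal_iff.2 (hg hK))
    have hz : Filter.Tendsto c g (𝓝 z) := hz
    have hz0 : 0 ≤ z := ge_of_tendsto' hz fun y => (hc y).1
    have hzL : L z = x := by
      refine tendsto_nhds_unique ((hL.tendsto z).comp hz) ?_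
      have hid : L ∘ c = id := funext hcL
      rw [hid]
      exact hg
    have hzq : q ⬝ᵥ z = q ⬝ᵥ c x := by
      have hdot : Continuous fun u : κ → ℝ => q ⬝ᵥ u := by
        unfold dotProduct
        fun_prop
      exact tendsto_nhds_unique ((hdot.tendsto z).comp hz)
        ((hlip.continuous.tendsto x).mono_left hg)
    have hopt : IsOptimal vec q z := ⟨hz0, fun u hu hux => by
      rw [hzq]
      exact (hc x).2 u hu (hux.trans (hzL.trans (hcL x).symm))⟩
    have := huniq z hopt
    rw [hzL] at this
    rwa [this]

end LinearProgram

/-! ### The antipodal quotient of an acute fan -/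

namespace IsAcuteFan

variable {κ ι : Type*} [Fintype κ] [Fintype ι] {vec : κ → ι → ℝ} {neg : κ → κ}
  {c : (ι → ℝ) → κ → ℝ}

theorem apply_zero (h : IsAcuteFan vec neg c) : c 0 = 0 := by
  simpa using h.eq_of_support 0 0 le_rfl fun _ _ => rfl

theorem apply_smul (h : IsAcuteFan vec neg c) {t : ℝ} (ht : 0 ≤ t) (x : ι → ℝ) :
    c (t • x) = t • c x := by
  have := h.eq_of_support x (t • c x) (smul_nonneg ht (h.nonneg x)) fun v hv => by simp [hv]
  rwa [map_smul, h.linearCombination_eq] at this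

theorem sum_pos (h : IsAcuteFan vec neg c) {x : ι → ℝ} (hx : x ≠ 0) : 0 < ∑ v, c x v := by
  refine (Finset.sum_nonneg fun v _ => h.nonneg x v).lt_of_ne fun h0 => hx ?_
  have : c x = 0 := by
    ext v
    exact (Finset.sum_eq_zero_iff_of_nonneg fun v _ => h.nonneg x v).1 h0.symm v
      (Finset.mem_univ v)
  rw [← h.linearCombination_eq x, this, map_zero]

variable {m : ℕ} {π : κ → Fin m}

/-- The complex whose simplices are the images of the cones of the fan after antipodal rays
have been identified along `π`. -/
noncomputable def complex (_ : IsAcuteFan vec neg c) (π : κ → Fin m) :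
    Geometry.SimplicialComplex ℝ (Fin m → ℝ) where
  faces := {F | F.Nonempty ∧
    ∃ x, (F : Set (Fin m → ℝ)) ⊆ (fun v => Pi.single (π v) 1) '' {v | c x v ≠ 0}}
  isRelLowerSet_faces := by
    rintro F ⟨hF, x, hx⟩
    exact ⟨hF, fun G hG hne => ⟨hne, x, (Finset.coe_subset.2 hG).trans hx⟩⟩
  indep := by
    rintro F ⟨-, x, hx⟩
    refine (Pi.basisFun ℝ (Fin m)).linearIndependent.affineIndependent.range.mono
      (hx.trans ?_)
    rintro _ ⟨v, -, rfl⟩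
    exact ⟨π v, by simp⟩
  inter_subset_convexHull := by
    rintro F G ⟨-, x, hx⟩ ⟨-, y, hy⟩
    classical
    -- All vertices are standard basis vectors, so even the union of two faces is affinely
    -- independent.
    refine (AffineIndependent.convexHull_inter (s := F ∪ G) ?_ Finset.subset_union_left
      Finset.subset_union_right).ge
    refine (Pi.basisFun ℝ (Fin m)).linearIndependent.affineIndependent.range.mono ?_
    rw [Finset.coe_union]
    refine (Set.union_subset_union hx hy).trans ?_
    rintro _ (⟨v, -, rfl⟩ | ⟨v, -, rfl⟩) <;> exact ⟨π v, by simp⟩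

theorem vertices_complex_subset (h : IsAcuteFan vec neg c) :
    (h.complex π).vertices ⊆ Set.range fun i : Fin m => (Pi.single i 1 : Fin m → ℝ) := by
  rintro z ⟨-, x, hx⟩
  obtain ⟨v, -, hv⟩ := hx (Finset.mem_coe.2 (Finset.mem_singleton_self z))
  exact ⟨π v, hv⟩

/-- The linear map which identifies antipodal coordinates along `π`. -/
noncomputable def fold (π : κ → Fin m) : (κ → ℝ) →ₗ[ℝ] Fin m → ℝ :=
  Fintype.linearCombination ℝ fun v => Pi.single (π v) 1

/-- Barycentric coordinates in the complex of the point with direction `x`. -/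
noncomputable def barycentric (c : (ι → ℝ) → κ → ℝ) (π : κ → Fin m) (x : ι → ℝ) : Fin m → ℝ :=
  (∑ v, c x v)⁻¹ • fold π (c x)

theorem barycentric_smul (h : IsAcuteFan vec neg c) {t : ℝ} (ht : 0 < t) (x : ι → ℝ) :
    barycentric c π (t • x) = barycentric c π x := by
  simp only [barycentric, h.apply_smul ht.le, map_smul, Pi.smul_apply, smul_eq_mul,
    ← Finset.mul_sum, smul_smul, mul_inv]
  congr 1
  field_simp

theorem fold_neg (h : IsAcuteFan vec neg c) (hinv : Function.Involutive neg)
    (hπ : ∀ v, π (neg v) = π v) (x : ι → ℝ) : fold π (c (-x)) = fold π (c x) := by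
  simp only [fold, Fintype.linearCombination_apply]
  refine (Fintype.sum_equiv hinv.toPerm _ _ fun v => ?_).symm
  simp [hπ, h.neg_apply]

theorem barycentric_neg (h : IsAcuteFan vec neg c) (hinv : Function.Involutive neg)
    (hπ : ∀ v, π (neg v) = π v) (x : ι → ℝ) :
    barycentric c π (-x) = barycentric c π x := by
  have : ∑ v, c (-x) v = ∑ v, c x v :=
    (Fintype.sum_equiv hinv.toPerm _ _ fun v => by simp [h.neg_apply]).symm
  rw [barycentric, barycentric, h.fold_neg hinv hπ, this]

theorem fold_apply (hneg : ∀ v, neg v ≠ v) (hπ : ∀ v w, π v = π w ↔ w = v ∨ w = neg v)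
    (a : κ → ℝ) (v : κ) : fold π a (π v) = a v + a (neg v) := by
  classical
  have hv : π (neg v) = π v := ((hπ v (neg v)).2 (Or.inr rfl)).symm
  rw [fold, Fintype.linearCombination_apply, Finset.sum_apply,
    Fintype.sum_eq_add v (neg v) (hneg v).symm fun w hw => ?_]
  · simp [hv]
  · have : π v ≠ π w := fun e => ((hπ v w).1 e).elim hw.1 hw.2
    simp [this]

omit [Fintype κ] [Fintype ι] in
theorem neg_ne (hneg : ∀ v, vec (neg v) = -vec v) (hvec : ∀ v, vec v ≠ 0) (v : κ) :
    neg v ≠ v := fun e => hvec v <| by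
  have := hneg v
  rwa [e, eq_neg_iff_add_eq_zero, ← two_smul ℝ, smul_eq_zero_iff_right two_ne_zero] at this

/-- Acuteness against the shared ray `v` rules out the same member of each pair `u`, `neg u` for
both points, so the folded coordinate determines the two unfolded ones. -/
theorem eq_of_fold_eq (h : IsAcuteFan vec neg c) (hneg : ∀ v, vec (neg v) = -vec v)
    (hvec : ∀ v, vec v ≠ 0) (hπ : ∀ v w, π v = π w ↔ w = v ∨ w = neg v) {x y : ι → ℝ}
    (hxy : fold π (c x) = fold π (c y)) {v : κ} (hx : c x v ≠ 0) (hy : c y v ≠ 0) : x = y := by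
  suffices c x = c y by rw [← h.linearCombination_eq x, this, h.linearCombination_eq]
  ext u
  have hsum := congrFun hxy (π u)
  rw [fold_apply (neg_ne hneg hvec) hπ, fold_apply (neg_ne hneg hvec) hπ] at hsum
  have h1 : ∀ z, c z v ≠ 0 → vec u ⬝ᵥ vec v ≤ 0 → c z u = 0 := fun z hz hle => by
    by_contra hc
    exact absurd (h.acute z u v hc hz) (not_lt.2 hle)
  have h2 : ∀ z, c z v ≠ 0 → 0 ≤ vec u ⬝ᵥ vec v → c z (neg u) = 0 := fun z hz hle => by
    by_contra hc
    have := h.acute z _ v hc hz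
    rw [hneg, neg_dotProduct] at this
    linarith
  rcases le_total (vec u ⬝ᵥ vec v) 0 with hle | hle
  · rw [h1 x hx hle, h1 y hy hle]
  · rwa [h2 x hx hle, h2 y hy hle, add_zero, add_zero] at hsum

/-- A ray `v` used by `x` must be used by `y` or by `-y`, since the folded coordinate of `y` there
is positive. -/
theorem eq_or_eq_neg_of_fold_eq (h : IsAcuteFan vec neg c) (hneg : ∀ v, vec (neg v) = -vec v)
    (hinv : Function.Involutive neg) (hvec : ∀ v, vec v ≠ 0)
    (hπ : ∀ v w, π v = π w ↔ w = v ∨ w = neg v) {x y : ι → ℝ} (hx : x ≠ 0)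
    (hxy : fold π (c x) = fold π (c y)) : x = y ∨ x = -y := by
  obtain ⟨v, hv⟩ : ∃ v, c x v ≠ 0 := by
    by_contra! hc
    exact hx (by rw [← h.linearCombination_eq x, funext hc]; exact map_zero _)
  have hsum := congrFun hxy (π v)
  rw [fold_apply (neg_ne hneg hvec) hπ, fold_apply (neg_ne hneg hvec) hπ] at hsum
  by_cases hy : c y v = 0
  · right
    refine h.eq_of_fold_eq hneg hvec hπ ?_ hv ?_
    · rw [hxy, h.fold_neg hinv fun v => ((hπ v (neg v)).2 (Or.inr rfl)).symm]
    · intro h0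
      have h1 := h.neg_apply y (neg v)
      rw [hinv v, h0] at h1
      have h2 : 0 < c x v := (h.nonneg x v).lt_of_ne (Ne.symm hv)
      have h3 : 0 ≤ c x (neg v) := h.nonneg x (neg v)
      linarith
  · exact Or.inl (h.eq_of_fold_eq hneg hvec hπ hxy hv hy)

theorem barycentric_mem_space (h : IsAcuteFan vec neg c) {x : ι → ℝ} (hx : x ≠ 0) :
    barycentric c π x ∈ (h.complex π).space := by
  classical
  set A : Finset κ := Finset.univ.filter fun v => c x v ≠ 0 with hA
  have hsum : ∑ v ∈ A, c x v = ∑ v, c x v := Finset.sum_filter_ne_zero _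
  have hpos := h.sum_pos hx
  refine Geometry.SimplicialComplex.mem_space_iff.2
    ⟨A.image fun v => Pi.single (π v) 1, ⟨?_, x, ?_⟩, ?_⟩
  · rw [Finset.image_nonempty]
    by_contra hc
    rw [Finset.not_nonempty_iff_eq_empty.1 hc, Finset.sum_empty] at hsum
    exact hpos.ne hsum
  · rw [Finset.coe_image, hA]
    simp
  · have : barycentric c π x =
        ∑ v ∈ A, ((∑ v, c x v)⁻¹ * c x v) • (Pi.single (π v) 1 : Fin m → ℝ) := by
      rw [barycentric, fold, Fintype.linearCombination_apply, Finset.smul_sum, hA,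
        Finset.sum_filter]
      refine Finset.sum_congr rfl fun v _ => ?_
      split_ifs with hv
      · rw [smul_smul]
      · rw [not_not.1 hv, zero_smul, smul_zero]
    rw [this]
    refine (convex_convexHull ℝ _).sum_mem
      (fun v _ => mul_nonneg (inv_nonneg.2 hpos.le) (h.nonneg x v)) ?_ fun v hv =>
      subset_convexHull ℝ _ (Finset.mem_coe.2 (Finset.mem_image_of_mem _ hv))
    rw [← Finset.mul_sum, hsum, inv_mul_cancel₀ hpos.ne']

/-- The vertices of a face lift to rays of a single cone, where the fan coordinates can be
prescribed freely. -/
theorem exists_barycentric_eq (h : IsAcuteFan vec neg c) {z : Fin m → ℝ}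
    (hz : z ∈ (h.complex π).space) : ∃ x, x ≠ 0 ∧ barycentric c π x = z := by
  classical
  obtain ⟨F, ⟨⟨y₀, hy₀⟩, x, hF⟩, hzF⟩ := Geometry.SimplicialComplex.mem_space_iff.1 hz
  obtain ⟨w, hw0, hw1, hwz⟩ := Finset.mem_convexHull'.1 hzF
  have : Nonempty κ := ⟨(hF hy₀).choose⟩
  have hF' : ∀ y ∈ F, ∃ v, c x v ≠ 0 ∧ Pi.single (π v) 1 = y := fun y hy => hF hy
  choose! s hs hs' using hF'
  let u : κ → ℝ := ∑ y ∈ F, w y • Pi.single (s y) 1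
  have hu0 : 0 ≤ u := Finset.sum_nonneg fun y hy =>
    smul_nonneg (hw0 y hy) (Pi.single_nonneg.2 zero_le_one)
  have hu1 : ∑ v, u v = 1 := by
    simp only [u, Finset.sum_apply, Pi.smul_apply, smul_eq_mul]
    rw [Finset.sum_comm]
    refine Eq.trans (Finset.sum_congr rfl fun y _ => ?_) hw1
    rw [← Finset.mul_sum, Finset.sum_pi_single']
    simp
  have hfold : fold π u = z := by
    simp only [u, map_sum, map_smul, fold, Fintype.linearCombination_apply_single, one_smul]
    rw [← hwz]
    exact Finset.sum_congr rfl fun y hy => by rw [hs' y hy]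
  have hc : c (Fintype.linearCombination ℝ vec u) = u := by
    refine h.eq_of_support x u hu0 fun v hv => ?_
    simp only [u, Finset.sum_apply, Pi.smul_apply, smul_eq_mul]
    refine Finset.sum_eq_zero fun y hy => ?_
    have : v ≠ s y := fun e => hs y hy (e ▸ hv)
    simp [this]
  refine ⟨Fintype.linearCombination ℝ vec u, fun h0 => ?_, ?_⟩
  · rw [h0, h.apply_zero] at hc
    rw [← hc] at hu1
    simp at hu1
  · rw [barycentric, hc, hu1, hfold, inv_one, one_smul]

theorem continuous_barycentric (h : IsAcuteFan vec neg c) :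
    Continuous fun x : {x : ι → ℝ // x ≠ 0} => barycentric c π x := by
  have hc : Continuous fun x : {x : ι → ℝ // x ≠ 0} => c x :=
    h.continuous.comp continuous_subtype_val
  refine Continuous.smul (Continuous.inv₀ ?_ fun x => (h.sum_pos x.2).ne')
    ((fold π).continuous_of_finiteDimensional.comp hc)
  exact continuous_finsetSum _ fun v _ => (continuous_apply v).comp hc

end IsAcuteFan

/-! ### Triangulating projective space -/

theorem Projectivization.continuous_mk' {ι : Type*} :
    Continuous (Projectivization.mk' ℝ : {x : ι → ℝ // x ≠ 0} → ℙ ℝ (ι → ℝ)) :=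
  continuous_quotient_mk'

instance Projectivization.compactSpace {ι : Type*} [Fintype ι] : CompactSpace (ℙ ℝ (ι → ℝ)) := by
  let f : Metric.sphere (0 : ι → ℝ) 1 → ℙ ℝ (ι → ℝ) := fun x =>
    Projectivization.mk' ℝ ⟨x, ne_zero_of_mem_unit_sphere x⟩
  have hf : Continuous f :=
    Projectivization.continuous_mk'.comp (continuous_subtype_val.subtype_mk _)
  refine Function.Surjective.compactSpace (f := f) hf fun p => ?_
  induction p using Projectivization.ind with
  | h v hv =>
    refine ⟨⟨‖v‖⁻¹ • v, by simp [norm_smul, hv]⟩, ?_⟩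
    exact (Projectivization.mk_eq_mk_iff' ℝ _ _ _ hv).2 ⟨‖v‖⁻¹, rfl⟩

/-- The antipodal quotient of an acute fan triangulates the real projective space. -/
theorem IsAcuteFan.exists_triangulation {κ ι : Type*} [Fintype κ] [Fintype ι]
    {vec : κ → ι → ℝ} {neg : κ → κ} {c : (ι → ℝ) → κ → ℝ} (h : IsAcuteFan vec neg c)
    (hneg : ∀ v, vec (neg v) = -vec v) (hinv : Function.Involutive neg) (hvec : ∀ v, vec v ≠ 0)
    {m : ℕ} {π : κ → Fin m} (hπ : ∀ v w, π v = π w ↔ w = v ∨ w = neg v) :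
    ∃ T : Triangulation (ℙ ℝ (ι → ℝ)), T.numVertices ≤ m := by
  have hπ' : ∀ v, π (neg v) = π v := fun v => ((hπ v (neg v)).2 (Or.inr rfl)).symm
  have hfin : (Set.range fun i : Fin m => (Pi.single i 1 : Fin m → ℝ)).Finite :=
    Set.finite_range _
  let f : ℙ ℝ (ι → ℝ) → (h.complex π).space :=
    Projectivization.lift (fun x => ⟨barycentric c π x, h.barycentric_mem_space x.2⟩) <| by
      rintro ⟨x, hx⟩ ⟨y, hy⟩ t (rfl : x = t • y)
      refine Subtype.ext ?_
      change barycentric c π (t • y) = barycentric c π y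
      rcases lt_trichotomy t 0 with ht | rfl | ht
      · rw [← h.barycentric_neg hinv hπ', ← neg_smul, h.barycentric_smul (neg_pos.2 ht)]
      · simp at hx
      · rw [h.barycentric_smul ht]
  have hf : Continuous f := Continuous.quotient_lift
    (h.continuous_barycentric.subtype_mk fun x => h.barycentric_mem_space x.2) _
  have hinj : Function.Injective f := by
    intro p q hpq
    induction p using Projectivization.ind with
    | h x hx =>
    induction q using Projectivization.ind with
    | h y hy =>
    have hxy : barycentric c π x = barycentric c π y := congrArg Subtype.val hpq
    have hs := h.sum_pos hx
    have ht := h.sum_pos hy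
    set s := ∑ v, c x v
    set t := ∑ v, c y v
    -- Rescaling to coefficient sum one turns barycentric coordinates into folded ones.
    have hfold : fold π (c (s⁻¹ • x)) = fold π (c (t⁻¹ • y)) := by
      rwa [h.apply_smul (inv_nonneg.2 hs.le), h.apply_smul (inv_nonneg.2 ht.le), map_smul,
        map_smul]
    have hx' : x = s • s⁻¹ • x := (smul_inv_smul₀ hs.ne' x).symm
    refine (Projectivization.mk_eq_mk_iff' ℝ _ _ _ hy).2 ?_
    rcases h.eq_or_eq_neg_of_fold_eq hneg hinv hvec hπ
      (smul_ne_zero (inv_ne_zero hs.ne') hx) hfold with e | e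
    · exact ⟨s * t⁻¹, by rw [hx', e, smul_smul]⟩
    · exact ⟨-(s * t⁻¹), by rw [hx', e, smul_neg, neg_smul, smul_smul]⟩
  have hsurj : Function.Surjective f := by
    rintro ⟨z, hz⟩
    obtain ⟨x, hx, rfl⟩ := h.exists_barycentric_eq hz
    exact ⟨Projectivization.mk ℝ x hx, rfl⟩
  refine ⟨⟨m, h.complex π, hfin.subset h.vertices_complex_subset,
    (Continuous.homeoOfEquivCompactToT2 (f := Equiv.ofBijective f ⟨hinj, hsurj⟩) hf).symm⟩, ?_⟩
  calc (h.complex π).vertices.ncard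
      ≤ (Set.range fun i : Fin m => (Pi.single i 1 : Fin m → ℝ)).ncard :=
        Set.ncard_le_ncard h.vertices_complex_subset hfin
    _ ≤ m := by
        rw [← Set.image_univ]
        refine (Set.ncard_image_le Set.finite_univ).trans ?_
        simp [Set.ncard_univ]

/-! ### Near transversals and their exchanges -/

/-- A sign vector that has at most one nonzero entry in every row (fibre of `r`), except for at
most one row. -/
def IsNearTransversal {ι R : Type*} (r : ι → R) (u : ι → SignType) : Prop :=
  ∃ i, ∀ s t, r s = r t → r s ≠ i → u s ≠ 0 → u t ≠ 0 → s = t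

/-- The nonzero near transversal sign vectors. -/
abbrev NearTransversal {ι R : Type*} (r : ι → R) : Type _ :=
  {u : ι → SignType // u ≠ 0 ∧ IsNearTransversal r u}

namespace NearTransversal

variable {ι R : Type*} {r : ι → R}

/-- The real vector of a sign vector. -/
def toReal (u : ι → SignType) : ι → ℝ := fun i => (u i : ℝ)

/-- The ray spanned by a near transversal sign vector. -/
def vec (u : NearTransversal r) : ι → ℝ := toReal u.1

theorem _root_.IsNearTransversal.mono {u v : ι → SignType} (hu : IsNearTransversal r u)
    (h : ∀ i, v i ≠ 0 → u i ≠ 0) : IsNearTransversal r v := by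
  obtain ⟨i, hi⟩ := hu
  exact ⟨i, fun s t hst hs hvs hvt => hi s t hst hs (h s hvs) (h t hvt)⟩

/-- The antipodal sign vector. -/
def antipode (u : NearTransversal r) : NearTransversal r :=
  ⟨fun i => -u.1 i, fun h => u.2.1 (funext fun i => by simpa using congrFun h i),
    u.2.2.mono fun i hi => by simpa using hi⟩

theorem antipode_involutive : Function.Involutive (antipode (r := r)) := fun u =>
  Subtype.ext (funext fun i => neg_neg (u.1 i))

theorem vec_antipode (u : NearTransversal r) : vec (antipode u) = -vec u := by
  ext i
  simp only [vec, toReal, antipode, Pi.neg_apply]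
  cases u.1 i <;> simp

theorem toReal_eq_zero {u : ι → SignType} {i : ι} : toReal u i = 0 ↔ u i = 0 := by
  unfold toReal
  cases u i <;> simp

theorem vec_ne_zero (u : NearTransversal r) : vec u ≠ 0 := fun h =>
  u.2.1 (funext fun i => toReal_eq_zero.1 (congrFun h i))

open Classical in
/-- The coefficient vector of a single sign vector. -/
noncomputable def coeff (r : ι → R) (u : ι → SignType) : NearTransversal r → ℝ :=
  if h : u ≠ 0 ∧ IsNearTransversal r u then Pi.single ⟨u, h⟩ 1 else 0

open Classical in
theorem coeff_nonneg (u : ι → SignType) : 0 ≤ coeff r u := by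
  unfold coeff
  split_ifs
  · exact Pi.single_nonneg.2 zero_le_one
  · exact le_rfl

variable [Fintype ι]

/-- The number of nonzero entries. -/
def size (u : ι → SignType) : ℕ := ∑ i, if u i = 0 then 0 else 1

theorem size_le (u : ι → SignType) : size u ≤ Fintype.card ι := by
  unfold size
  rw [Fintype.card_eq_sum_ones]
  exact Finset.sum_le_sum fun i _ => by split_ifs <;> simp

theorem size_pos {u : ι → SignType} (hu : u ≠ 0) : 0 < size u := by
  obtain ⟨i, hi⟩ := Function.ne_iff.1 hu
  have hi : u i ≠ 0 := hi
  exact Finset.sum_pos' (fun _ _ => Nat.zero_le _) ⟨i, Finset.mem_univ i, by simp [hi]⟩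

theorem size_update [DecidableEq ι] (u : ι → SignType) (t : ι) (x : SignType) :
    size (Function.update u t x) + (if u t = 0 then 0 else 1) =
      size u + (if x = 0 then 0 else 1) := by
  unfold size
  rw [← Finset.add_sum_erase _ _ (Finset.mem_univ t),
    ← Finset.add_sum_erase Finset.univ (fun i => if u i = 0 then 0 else 1) (Finset.mem_univ t),
    Finset.sum_congr rfl fun i hi => by rw [Function.update_of_ne (Finset.ne_of_mem_erase hi)],
    Function.update_self]
  omega

/-- The cost of a sign vector, a strictly increasing and strictly concave function of its size. -/
def cost (u : ι → SignType) : ℝ := size u * (2 * Fintype.card ι - size u)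

theorem cost_zero : cost (0 : ι → SignType) = 0 := by
  simp [cost, size]

theorem cost_pos {u : ι → SignType} (hu : u ≠ 0) : 0 < cost u := by
  have h1 : (0 : ℝ) < size u := by exact_mod_cast size_pos hu
  have h2 : (size u : ℝ) ≤ Fintype.card ι := by exact_mod_cast size_le u
  exact mul_pos h1 (by linarith)

theorem cost_antipode (u : NearTransversal r) : cost (antipode u).1 = cost u.1 := by
  simp [cost, size, antipode]

variable [Fintype (NearTransversal r)]

open Classical in
theorem linearCombination_coeff {u : ι → SignType} (hu : IsNearTransversal r u) :
    Fintype.linearCombination ℝ vec (coeff r u) = toReal u := by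
  unfold coeff
  split_ifs with h
  · rw [Fintype.linearCombination_apply_single, one_smul]
    rfl
  · have : u = 0 := by
      by_contra h0
      exact h ⟨h0, hu⟩
    ext i
    simp [this, toReal]

open Classical in
theorem cost_coeff {u : ι → SignType} (hu : IsNearTransversal r u) :
    (fun v : NearTransversal r => cost v.1) ⬝ᵥ coeff r u = cost u := by
  unfold coeff
  split_ifs with h
  · simp
  · have : u = 0 := by
      by_contra h0
      exact h ⟨h0, hu⟩
    simp [this, cost_zero]

/-- Some positive combination of `u` and `v` is a cheaper combination of near transversals. -/
def Exchangeable (r : ι → R) [Fintype (NearTransversal r)] (u v : ι → SignType) : Prop :=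
  ∃ a b : ℝ, ∃ w : NearTransversal r → ℝ, 0 < a ∧ 0 < b ∧ 0 ≤ w ∧
    Fintype.linearCombination ℝ vec w = a • toReal u + b • toReal v ∧
    (fun v : NearTransversal r => cost v.1) ⬝ᵥ w < a * cost u + b * cost v

theorem Exchangeable.symm {u v : ι → SignType} (h : Exchangeable r u v) : Exchangeable r v u := by
  obtain ⟨a, b, w, ha, hb, hw, h1, h2⟩ := h
  exact ⟨b, a, w, hb, ha, hw, by rw [h1, add_comm], by rwa [add_comm]⟩

variable [DecidableEq ι] {u v : ι → SignType}

/-- The opposite entries cancel in `u + v`, so both can be deleted; the cost increases strictly with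
size. -/
theorem exchangeable_of_opposite (hu : IsNearTransversal r u) (hv : IsNearTransversal r v)
    {t : ι} (hut : u t ≠ 0) (huv : u t = -v t) : Exchangeable r u v := by
  have hvt : v t ≠ 0 := fun h => hut (by rw [huv, h, neg_zero])
  have key : ∀ {w : ι → SignType}, IsNearTransversal r w → w t ≠ 0 →
      IsNearTransversal r (Function.update w t 0) ∧ cost (Function.update w t 0) < cost w := by
    intro w hw hwt
    refine ⟨hw.mono fun i hi => ?_, ?_⟩
    · by_cases hit : i = t
      · rwa [hit]
      · rwa [Function.update_of_ne hit] at hi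
    · have h1 := size_update w t 0
      rw [if_neg hwt, if_pos rfl, add_zero] at h1
      have h2 : (size w : ℝ) ≤ Fintype.card ι := by exact_mod_cast size_le w
      unfold cost
      rw [← h1] at h2 ⊢
      push_cast at h2 ⊢
      nlinarith
  obtain ⟨hu1, hu2⟩ := key hu hut
  obtain ⟨hv1, hv2⟩ := key hv hvt
  refine ⟨1, 1, coeff r (Function.update u t 0) + coeff r (Function.update v t 0), one_pos,
    one_pos, add_nonneg (coeff_nonneg _) (coeff_nonneg _), ?_, ?_⟩
  · rw [map_add, linearCombination_coeff hu1, linearCombination_coeff hv1]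
    ext i
    by_cases hit : i = t
    · subst hit
      simp only [toReal, huv, Function.update_self, Pi.add_apply, Pi.smul_apply]
      cases v i <;> simp
    · simp [toReal, hit]
  · rw [dotProduct_add, cost_coeff hu1, cost_coeff hv1]
    linarith

/-- Moving an entry from the smaller vector to the larger spreads the sizes apart, which is cheaper
by strict concavity. -/
theorem exchangeable_of_update (hv : IsNearTransversal r v) (hle : size v ≤ size u) {t : ι}
    (hut : u t = 0) (hvt : v t ≠ 0) (hr : IsNearTransversal r (Function.update u t (v t))) :
    Exchangeable r u v := by
  have hv1 : IsNearTransversal r (Function.update v t 0) := hv.mono fun i hi => by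
    by_cases hit : i = t
    · rwa [hit]
    · rwa [Function.update_of_ne hit] at hi
  refine ⟨1, 1, coeff r (Function.update u t (v t)) + coeff r (Function.update v t 0), one_pos,
    one_pos, add_nonneg (coeff_nonneg _) (coeff_nonneg _), ?_, ?_⟩
  · rw [map_add, linearCombination_coeff hr, linearCombination_coeff hv1]
    ext i
    by_cases hit : i = t
    · subst hit
      simp [toReal, hut]
    · simp [toReal, hit]
  · rw [dotProduct_add, cost_coeff hr, cost_coeff hv1]
    have h1 := size_update u t (v t)
    have h2 := size_update v t 0
    rw [if_pos hut, if_neg hvt, add_zero] at h1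
    rw [if_neg hvt, if_pos rfl, add_zero] at h2
    have hle : (size v : ℝ) ≤ size u := by exact_mod_cast hle
    unfold cost
    rw [h1]
    rw [← h2] at hle ⊢
    push_cast at hle ⊢
    nlinarith

/-- When `u` has no room for `t`, it trades `s` for `t`. Using `u + 2 • v` leaves one copy of `v` to
receive `s` and the other to give up `t`: the size of `u` is kept and the two copies of `v` spread
apart. -/
theorem exchangeable_of_swap {s t : ι} (hus : u s ≠ 0) (hvs : v s = 0) (hut : u t = 0)
    (hvt : v t ≠ 0)
    (h1 : IsNearTransversal r (Function.update (Function.update u s 0) t (v t)))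
    (h2 : IsNearTransversal r (Function.update v s (u s)))
    (h3 : IsNearTransversal r (Function.update v t 0)) : Exchangeable r u v := by
  have hst : s ≠ t := fun e => hus (e ▸ hut)
  refine ⟨1, 2, coeff r (Function.update (Function.update u s 0) t (v t)) +
    coeff r (Function.update v s (u s)) + coeff r (Function.update v t 0), one_pos, two_pos,
    add_nonneg (add_nonneg (coeff_nonneg _) (coeff_nonneg _)) (coeff_nonneg _), ?_, ?_⟩
  · rw [map_add, map_add, linearCombination_coeff h1, linearCombination_coeff h2,
      linearCombination_coeff h3]
    ext i
    by_cases hit : i = t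
    · subst hit
      simp [toReal, hut, hst.symm]
      ring
    · by_cases his : i = s
      · subst his
        simp [toReal, hvs, hst]
      · simp [toReal, hit, his]
        ring
  · rw [dotProduct_add, dotProduct_add, cost_coeff h1, cost_coeff h2, cost_coeff h3]
    have e1 := size_update (Function.update u s 0) t (v t)
    have e2 := size_update u s 0
    have e3 := size_update v s (u s)
    have e4 := size_update v t 0
    rw [Function.update_of_ne hst.symm, if_pos hut, if_neg hvt, add_zero] at e1
    rw [if_neg hus, if_pos rfl, add_zero] at e2
    rw [if_pos hvs, if_neg hus, add_zero] at e3
    rw [if_neg hvt, if_pos rfl, add_zero] at e4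
    unfold cost
    rw [e1, e2, e3, ← e4]
    push_cast
    nlinarith

theorem exchangeable_of_disjoint (hu : IsNearTransversal r u) (hv : IsNearTransversal r v)
    (hv0 : v ≠ 0) (hle : size v ≤ size u) (hdisj : ∀ t, u t = 0 ∨ v t = 0) :
    Exchangeable r u v := by
  by_cases hA : ∃ t, v t ≠ 0 ∧ IsNearTransversal r (Function.update u t (v t))
  · obtain ⟨t, hvt, ht⟩ := hA
    exact exchangeable_of_update hv hle ((hdisj t).resolve_right hvt) hvt ht
  push Not at hA
  have hu' := hu
  obtain ⟨i, hi⟩ := hu'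
  -- An entry of `v` can fail to fit into `u` only if its row is not free for `u` and is already
  -- occupied.
  have hrow : ∀ t, v t ≠ 0 → r t ≠ i ∧ ∃ s, r s = r t ∧ u s ≠ 0 := by
    intro t hvt
    by_contra hc
    refine hA t hvt ⟨i, fun a b hab ha hua hub => ?_⟩
    have hti : r t ≠ i → ∀ s, r s = r t → u s = 0 := by
      intro h s hs
      by_contra h0
      exact hc ⟨h, s, hs, h0⟩
    by_cases hat : a = t <;> by_cases hbt : b = t
    · rw [hat, hbt]
    · subst hat
      rw [Function.update_of_ne hbt] at hub
      exact absurd (hti ha b hab.symm) hub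
    · subst hbt
      rw [Function.update_of_ne hat] at hua
      exact absurd (hti (hab ▸ ha) a hab) hua
    · rw [Function.update_of_ne hat] at hua
      rw [Function.update_of_ne hbt] at hub
      exact hi a b hab ha hua hub
  -- If `v` vanishes on its free row, any row it meets can be declared free instead. The row `j` can
  -- then absorb the entry `s` of `u`.
  obtain ⟨j, hj, t, htj, hvt⟩ : ∃ j, (∀ s t, r s = r t → r s ≠ j → v s ≠ 0 → v t ≠ 0 → s = t) ∧
      ∃ t, r t = j ∧ v t ≠ 0 := by
    obtain ⟨j, hj⟩ := hv
    by_cases h : ∃ t, r t = j ∧ v t ≠ 0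
    · exact ⟨j, hj, h⟩
    · push Not at h
      obtain ⟨t, ht⟩ := Function.ne_iff.1 hv0
      exact ⟨r t, fun a b hab _ ha hb => hj a b hab (fun e => ha (h a e)) ha hb, t, rfl, ht⟩
  obtain ⟨hti, s, hst, hus⟩ := hrow t hvt
  have hvs := (hdisj s).resolve_left hus
  have hut := (hdisj t).resolve_right hvt
  refine exchangeable_of_swap hus hvs hut hvt ⟨i, fun a b hab ha hua hub => ?_⟩
    ⟨j, fun a b hab ha hua hub => ?_⟩ (hv.mono fun k hk => ?_)
  · have hz : ∀ c, r c = r t → Function.update (Function.update u s 0) t (v t) c ≠ 0 → c = t := by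
      intro c hc huc
      by_contra hct
      rw [Function.update_of_ne hct] at huc
      by_cases hcs : c = s
      · rw [hcs, Function.update_self] at huc
        exact huc rfl
      · rw [Function.update_of_ne hcs] at huc
        exact hcs (hi c s (hc.trans hst.symm) (hc ▸ hti) huc hus)
    by_cases hat : r a = r t
    · rw [hz a hat hua, hz b (hab ▸ hat) hub]
    · have hz' : ∀ c, r c ≠ r t →
          Function.update (Function.update u s 0) t (v t) c ≠ 0 → u c ≠ 0 := by
        intro c hc huc
        rw [Function.update_of_ne (fun e => hc (by rw [e])),
          Function.update_of_ne (fun e => hc (by rw [e, hst]))] at huc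
        exact huc
      exact hi a b hab ha (hz' a hat hua) (hz' b (hab ▸ hat) hub)
  · have hz : ∀ c, r c ≠ j → Function.update v s (u s) c ≠ 0 → v c ≠ 0 := by
      intro c hc hvc
      rwa [Function.update_of_ne (fun e => hc (by rw [e, hst, htj]))] at hvc
    exact hj a b hab ha (hz a ha hua) (hz b (hab ▸ ha) hub)
  · by_cases hkt : k = t
    · rwa [hkt]
    · rwa [Function.update_of_ne hkt] at hk

/-- Without opposite entries all products of entries are nonnegative, so a nonpositive scalar
product forces disjoint supports. -/
theorem hasExchange : HasExchange (vec (r := r)) fun v => cost v.1 := by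
  rintro ⟨u, hu0, hu⟩ ⟨v, hv0, hv⟩ hle
  suffices Exchangeable r u v from this
  by_cases hopp : ∃ t, u t ≠ 0 ∧ u t = -v t
  · obtain ⟨t, hut, huv⟩ := hopp
    exact exchangeable_of_opposite hu hv hut huv
  push Not at hopp
  have hnn : ∀ i ∈ Finset.univ, 0 ≤ toReal u i * toReal v i := by
    intro i _
    have := hopp i
    unfold toReal
    revert this
    cases u i <;> cases v i <;> simp
  have hz : ∀ t, u t = 0 ∨ v t = 0 := by
    intro t
    have h0 : ∑ i, toReal u i * toReal v i = 0 := le_antisymm hle (Finset.sum_nonneg hnn)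
    have := (Finset.sum_eq_zero_iff_of_nonneg hnn).1 h0 t (Finset.mem_univ t)
    rwa [mul_eq_zero, toReal_eq_zero, toReal_eq_zero] at this
  rcases le_total (size v) (size u) with h | h
  · exact exchangeable_of_disjoint hu hv hv0 h hz
  · exact (exchangeable_of_disjoint hv hu hu0 h fun t => (hz t).symm).symm

end NearTransversal

/-! ### Counting near transversals -/

namespace NearTransversal

variable {ι R C : Type*}

/-- Identification of antipodal sign vectors. -/
def antipodeSetoid (r : ι → R) : Setoid (NearTransversal r) where
  r u v := v = u ∨ v = antipode u
  iseqv :=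
    { refl := fun _ => Or.inl rfl
      symm := by
        rintro u v (rfl | rfl)
        · exact Or.inl rfl
        · exact Or.inr (antipode_involutive u).symm
      trans := by
        rintro u v w (rfl | rfl) (rfl | rfl)
        · exact Or.inl rfl
        · exact Or.inr rfl
        · exact Or.inr rfl
        · exact Or.inl (antipode_involutive u) }

theorem exists_triangulation [Fintype ι] (r : ι → R) :
    ∃ T : Triangulation (ℙ ℝ (ι → ℝ)),
      T.numVertices ≤ Nat.card (Quotient (antipodeSetoid r)) := by
  classical
  have : Fintype (NearTransversal r) := Fintype.ofFinite _
  let π : NearTransversal r → Fin (Nat.card (Quotient (antipodeSetoid r))) := fun u =>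
    Finite.equivFin _ (Quotient.mk _ u)
  have hπ : ∀ u v, π u = π v ↔ v = u ∨ v = antipode u := fun u v => by
    rw [(Finite.equivFin _).apply_eq_iff_eq]
    exact Quotient.eq
  have hspan : ∀ i, ∃ u : NearTransversal r, vec u = Pi.single i 1 := by
    intro i
    have hi : ∀ s, (Pi.single i 1 : ι → SignType) s ≠ 0 → s = i := by
      intro s hs
      by_contra h
      exact hs (Pi.single_eq_of_ne h _)
    refine ⟨⟨Pi.single i 1, by simp,
      r i, fun s t _ _ hs ht => (hi s hs).trans (hi t ht).symm⟩, ?_⟩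
    ext s
    by_cases h : s = i
    · subst h
      simp [vec, toReal]
    · simp [vec, toReal, h]
  obtain ⟨c, hc⟩ := exists_isAcuteFan (vec := vec (r := r)) (neg := antipode)
    (p := fun u => cost u.1) (e := fun u => π u) vec_antipode antipode_involutive
    (fun u v h => (hπ u v).1 (Fin.ext h))
    (fun u => congrArg _ ((hπ u (antipode u)).2 (Or.inr rfl)).symm)
    (fun u => cost_pos u.2.1) cost_antipode hasExchange hspan
  exact hc.exists_triangulation vec_antipode antipode_involutive vec_ne_zero hπ

/-- A near transversal is determined by its exceptional row, its entries in this row, and the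
position and value of the nonzero entry in every other row. -/
theorem card_le [Finite R] [Finite C] (r : ι → R) (q : ι → C)
    (h : ∀ s t, r s = r t → q s = q t → s = t) :
    Nat.card (NearTransversal r) ≤ Nat.card R * 3 ^ Nat.card C * (Nat.card C * 3) ^ Nat.card R := by
  classical
  let decode : (R × (C → SignType)) × (R → C × SignType) → ι → SignType := fun x s =>
    if r s = x.1.1 then x.1.2 (q s) else
      if (x.2 (r s)).1 = q s then (x.2 (r s)).2 else 0
  have hdec : ∀ u : NearTransversal r, ∃ x, decode x = u.1 := by
    rintro ⟨u, hu0, i, hi⟩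
    obtain ⟨s₀, -⟩ := Function.ne_iff.1 hu0
    have ha : ∀ c, ∃ x, ∀ s, r s = i → q s = c → u s = x := by
      intro c
      by_cases hex : ∃ s, r s = i ∧ q s = c
      · obtain ⟨s, hs, hsc⟩ := hex
        exact ⟨u s, fun t ht htc => by rw [h s t (hs.trans ht.symm) (hsc.trans htc.symm)]⟩
      · exact ⟨0, fun t ht htc => absurd ⟨t, ht, htc⟩ hex⟩
    have hT : ∀ j, ∃ y : C × SignType, j ≠ i → ∀ s, r s = j →
        u s = if y.1 = q s then y.2 else 0 := by
      intro j
      by_cases hex : ∃ s, r s = j ∧ u s ≠ 0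
      · obtain ⟨s, hs, hus⟩ := hex
        refine ⟨(q s, u s), fun hj t ht => ?_⟩
        split_ifs with hq
        · rw [h s t (hs.trans ht.symm) hq]
        · by_contra hut
          exact hq (by rw [hi s t (hs.trans ht.symm) (hs ▸ hj) hus hut])
      · push Not at hex
        -- The sign `0` encodes an empty row; `q s₀` is an arbitrary column.
        exact ⟨(q s₀, 0), fun hj t ht => by rw [hex t ht, ite_self]⟩
    choose a ha using ha
    choose T hT using hT
    refine ⟨((i, a), T), funext fun s => ?_⟩
    simp only [decode]
    split_ifs with h1 h2
    · exact (ha _ s h1 rfl).symm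
    · rw [hT (r s) h1 s rfl, if_pos h2]
    · rw [hT (r s) h1 s rfl, if_neg h2]
  choose code hcode using hdec
  have hinj : Function.Injective code := fun u v huv =>
    Subtype.ext (by rw [← hcode u, huv, hcode])
  have h3 : Nat.card SignType = 3 := by
    rw [Nat.card_eq_fintype_card]
    rfl
  refine (Nat.card_le_card_of_injective code hinj).trans_eq ?_
  rw [Nat.card_prod, Nat.card_prod, Nat.card_fun, Nat.card_fun, Nat.card_prod, h3]

end NearTransversal

/-! ### Vertex bounds for real projective spaces -/

theorem exists_triangulation_realProjectiveSpace_zero :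
    ∃ T : Triangulation (RealProjectiveSpace 0), T.numVertices ≤ 1 := by
  obtain ⟨T, hT⟩ := NearTransversal.exists_triangulation (id : Fin (0 + 1) → Fin (0 + 1))
  refine ⟨T, hT.trans (Finite.card_le_one_iff_subsingleton.2 ⟨fun x y => ?_⟩)⟩
  induction x using Quotient.inductionOn with | h u =>
  induction y using Quotient.inductionOn with | h v =>
  refine Quotient.sound ?_
  have hi : ∀ i : Fin (0 + 1), i = 0 := fun i => Fin.ext (by lia)
  have key : ∀ w : NearTransversal (id : Fin (0 + 1) → Fin (0 + 1)), w.1 0 ≠ 0 := fun w hw =>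
    w.2.1 (funext fun i => by rw [hi i, hw]; rfl)
  have h : v.1 0 = u.1 0 ∨ v.1 0 = -u.1 0 := by
    have hu := key u
    have hv := key v
    revert hu hv
    cases u.1 0 <;> cases v.1 0 <;> simp
  rcases h with h | h
  · exact Or.inl (Subtype.ext (funext fun i => by rw [hi i, h]))
  · exact Or.inr (Subtype.ext (funext fun i => by rw [hi i, h]; rfl))

/-- Division with remainder by `m` places the coordinates in an `m × m` grid. -/
theorem exists_triangulation_realProjectiveSpace (d m : ℕ) (h : d + 1 ≤ m * m) :
    ∃ T : Triangulation (RealProjectiveSpace d),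
      T.numVertices ≤ m * 3 ^ m * (m * 3) ^ m := by
  have hm : 0 < m := by
    by_contra h0
    simp [Nat.eq_zero_of_not_pos h0] at h
  let r : Fin (d + 1) → Fin m := fun s => ⟨s / m, Nat.div_lt_of_lt_mul (s.2.trans_le h)⟩
  let q : Fin (d + 1) → Fin m := fun s => ⟨s % m, Nat.mod_lt _ hm⟩
  obtain ⟨T, hT⟩ := NearTransversal.exists_triangulation r
  refine ⟨T, hT.trans ((Nat.card_le_card_of_surjective _ Quotient.mk_surjective).trans ?_)⟩
  have := NearTransversal.card_le r q fun s t hr hq => Fin.ext <| by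
    rw [← Nat.div_add_mod s m, ← Nat.div_add_mod t m, Fin.mk.inj_iff.1 hr, Fin.mk.inj_iff.1 hq]
  simpa only [Nat.card_eq_fintype_card, Fintype.card_fin] using this

/-! ### Asymptotics of the bound -/

open Filter in
theorem tendsto_log_bound_div :
    Tendsto (fun n : ℕ => Real.log (((n.sqrt + 1) * 3 ^ (n.sqrt + 1) *
      ((n.sqrt + 1) * 3) ^ (n.sqrt + 1) : ℕ) : ℝ) / (Real.sqrt n * Real.log n)) atTop
      (𝓝 (1 / 2)) := by
  set M : ℕ → ℝ := fun n => (n.sqrt : ℝ) + 1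
  have hM : ∀ n, 0 < M n := fun n => by positivity
  have hsqrt : Tendsto (fun n : ℕ => (Real.sqrt n)⁻¹) atTop (𝓝 0) :=
    tendsto_inv_atTop_zero.comp (Real.tendsto_sqrt_atTop.comp tendsto_natCast_atTop_atTop)
  have hlog : Tendsto (fun n : ℕ => (Real.log n)⁻¹) atTop (𝓝 0) :=
    tendsto_inv_atTop_zero.comp (Real.tendsto_log_atTop.comp tendsto_natCast_atTop_atTop)
  have ha : Tendsto (fun n : ℕ => M n * (Real.sqrt n)⁻¹) atTop (𝓝 1) := by
    refine tendsto_of_tendsto_of_tendsto_of_le_of_le' tendsto_const_nhds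
      (by simpa using tendsto_const_nhds.add hsqrt : Tendsto (fun n : ℕ => 1 + (Real.sqrt n)⁻¹)
        atTop (𝓝 1)) ?_ ?_
    · filter_upwards [eventually_gt_atTop 0] with n hn
      have hs : 0 < Real.sqrt n := Real.sqrt_pos.2 (by exact_mod_cast hn)
      rw [← div_eq_mul_inv, one_le_div hs]
      exact Real.real_sqrt_le_nat_sqrt_succ
    · filter_upwards [eventually_gt_atTop 0] with n hn
      have hs : 0 < Real.sqrt n := Real.sqrt_pos.2 (by exact_mod_cast hn)
      have h1 : (n.sqrt : ℝ) ≤ Real.sqrt n := Real.nat_sqrt_le_real_sqrt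
      rw [← div_eq_mul_inv, div_le_iff₀ hs, add_mul, inv_mul_cancel₀ hs.ne']
      linarith
  have hb : Tendsto (fun n : ℕ => Real.log (M n) * (Real.log n)⁻¹) atTop (𝓝 (1 / 2)) := by
    -- Split `log M` as `log (M / √n) + (log n) / 2`.
    have h1 : Tendsto (fun n : ℕ => Real.log (M n * (Real.sqrt n)⁻¹) * (Real.log n)⁻¹ + 1 / 2)
        atTop (𝓝 (Real.log 1 * 0 + 1 / 2)) :=
      ((ha.log one_ne_zero).mul hlog).add tendsto_const_nhds
    rw [mul_zero, zero_add] at h1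
    refine h1.congr' ?_
    filter_upwards [eventually_gt_atTop 1] with n hn
    have hn' : (1 : ℝ) < n := by exact_mod_cast hn
    have hs : 0 < Real.sqrt n := Real.sqrt_pos.2 (by linarith)
    have hl : Real.log n ≠ 0 := (Real.log_pos hn').ne'
    rw [Real.log_mul (hM n).ne' (inv_ne_zero hs.ne'), Real.log_inv,
      Real.log_sqrt (by linarith)]
    field_simp
    ring
  -- The logarithm of the bound is `log M + 2 M log 3 + M log M`; only the last term survives
  -- division by `√n log n`.
  have htot := ((hsqrt.mul hb).add ((ha.mul hlog).const_mul (2 * Real.log 3))).add (ha.mul hb)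
  norm_num at htot
  norm_num
  refine htot.congr fun n => ?_
  rw [Real.log_mul, Real.log_mul, Real.log_pow, Real.log_pow, Real.log_mul]
  · simp only [M]
    push_cast
    ring
  all_goals positivity

theorem corollary2 :
    ∃ ε : ℕ → ℝ, Filter.Tendsto ε Filter.atTop (𝓝 0) ∧
      ∀ n : ℕ, 1 ≤ n →
        ∃ T : Triangulation (RealProjectiveSpace (n - 1)),
          (T.numVertices : ℝ) ≤
            Real.exp ((1 / 2 + ε n) * Real.sqrt (n : ℝ) * Real.log (n : ℝ)) := by

  -- This `ε` makes the target equal to the vertex bound for `n ≥ 2`. At `n = 1` the target is `1`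
  -- whatever `ε` is, so a one-vertex triangulation is needed there.
  refine ⟨fun n => Real.log (((n.sqrt + 1) * 3 ^ (n.sqrt + 1) *
    ((n.sqrt + 1) * 3) ^ (n.sqrt + 1) : ℕ) : ℝ) / (Real.sqrt n * Real.log n) - 1 / 2, ?_, ?_⟩
  · simpa using tendsto_log_bound_div.sub_const (1 / 2)
  intro n hn
  rcases hn.eq_or_lt with rfl | hn
  · obtain ⟨T, hT⟩ := exists_triangulation_realProjectiveSpace_zero
    refine ⟨T, ?_⟩
    rw [Nat.cast_one, Real.log_one, mul_zero, Real.exp_zero]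
    exact_mod_cast hT
  · obtain ⟨T, hT⟩ := exists_triangulation_realProjectiveSpace (n - 1) (n.sqrt + 1)
      (by have := Nat.lt_succ_sqrt n; lia)
    refine ⟨T, (Nat.cast_le.2 hT).trans_eq ?_⟩
    have hn' : (1 : ℝ) < n := by exact_mod_cast hn
    have hl : 0 < Real.log n := Real.log_pos hn'
    have hs : 0 < Real.sqrt n := Real.sqrt_pos.2 (by linarith)
    rw [add_sub_cancel, mul_assoc (_ / _), div_mul_cancel₀ _ (mul_pos hs hl).ne', Real.exp_log]
    exact Nat.cast_pos.2 (by positivity)
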